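/- **Setting.** Let $\Gamma$ be a countably infinite, totally ordered domain of values. A *schema* $\mathcal G$ consists of relation names with arities and of integrity constraints of two kinds: - *denial constraints* (DCs) $\forall\,\neg[r_1(\mathbf x_1)\wedge\dots\wedge r_m(\mathbf x_m)\wedge\sigma]$ with $m\ge 1$, where $\sigma$ is a conjunction of comparisons $X\odot X'$, $\odot\in\{\le,\ge,<,>,\ne\}$, between variables of $\mathbf x_1,\dots,\mathbf x_m$; - *inclusion dependencies* (INDs) $d$ of the form $r_1(\mathbf x_1)\to\exists\,\mathbf x_{2\exists}\; r_2(\mathbf x_2)$, where the variables in each $\mathbf x_i$ are pairwise distinct and $\mathbf x_{2\exists}$ consists of the variables of $\mathbf x_2$ that do not occur in $\mathbf x_1$. Let $\pi_L^d$ and $\pi_R^d$ be the sets of positions in $\mathbf x_1$ and in $\mathbf x_2$ of the variables shared by $\mathbf x_1$ and $\mathbf x_2$. A *key dependency* (KD) with key $\pi=key(r)$ for $r$ is the set of DCs $\forall\,\neg[r(\mathbf x_1)\wedge r(\mathbf x_2)\wedge \mathbf x_1^i\neq \mathbf x_2^i]$, one for each position $i\notin\pi$, where no variable is repeated inside $\mathbf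 x_1$ or inside $\mathbf x_2$, and $\mathbf x_1,\mathbf x_2$ share exactly the variables at the positions in $\pi$, each at the same position in both. At most one KD is given for each relation, and $key(r)$ is the set of all positions of $r$ if there is no DC on $r$. An IND $d$ is a *foreign key* (FK) if $\pi_R^d=key(r_2)$, and a *safe foreign key* (SFK) if moreover $\pi_L^d\subseteq key(r_1)$. A *database* is a set of facts $r(t)$ with $t$ a tuple over $\Gamma$; it is *consistent* if it satisfies all constraints of $\mathcal G$. A *loosely-exact repair* for $\mathcal D$ is a consistent database $\mathcal B$ such that no consistent $\mathcal B'$ satisfies $\mathcal B'\ominus\mathcal D\subsetneq\mathcal B\ominus\mathcal D$ ($\ominus$ is symmetric difference). A *union of conjunctive queries* (UCQ) $q(\mathbf x)$ is a finite disjunction of formulas $\exists\cdots\, r_1(\mathbf x_1)\wedge\dots\wedge r_m(\mathbf x_m)\wedge\sigma$ with the same free variables $\mathbf x$ (distinct, each occurring in a relational atom of every disjunct), where $\sigma$ is a conjunction of comparisons between variables of the relational atoms; $ans(q,\mathcal B)=\{t:\mathcal B\models q(t)\}$. The set $ans_{loosely\text{-}exact}(q,\mathcal G,\mathcal D)$ consists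 of the tuples $t$ over $\Gamma$ with $t\in ans(q,\mathcal B)$ for every loosely-exact repair $\mathcal B$ for $\mathcal D$. **Encoding.** The disjunctive logic program $P_{cqa}$ has, for each relation name $g$, predicates $g,g^c,g^r$, and a query predicate $q_{cqa}$. Its rules are: 1. for each DC: $\;g_1^c(\mathbf x_1)\vee\dots\vee g_m^c(\mathbf x_m)\leftarrow g_1(\mathbf x_1),\dots,g_m(\mathbf x_m),\sigma$; 2. for each IND $g_1(\mathbf x_1)\to\exists\mathbf x_{2\exists}\,g_2(\mathbf x_2)$ with $|\mathbf x_{2\exists}|>0$: $\;g_1^c(\mathbf x_1)\leftarrow g_1(\mathbf x_1),\ \#count\{\mathbf x_{2\exists}:g_2^c(\mathbf x_2)\}=\#count\{\mathbf x_{2\exists}:g_2(\mathbf x_2)\}$; 3. for each IND with $|\mathbf x_{2\exists}|=0$: $\;g_1^c(\mathbf x_1)\leftarrow g_1(\mathbf x_1),\,g_2^c(\mathbf x_2)$ and $\;g_1^c(\mathbf x_1)\leftarrow g_1(\mathbf x_1),\,not\ g_2(\mathbf x_2)$; 4. for each relation name $g$: $\;g^r(\mathbf x)\leftarrow g(\mathbf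 x),\,not\ g^c(\mathbf x)$; 5. for each disjunct of $q$: $\;q_{cqa}(\mathbf x)\leftarrow g_1^r(\mathbf y_1),\dots,g_m^r(\mathbf y_m),\sigma$, where $g_1(\mathbf y_1),\dots,g_m(\mathbf y_m)$ are the relational atoms and $\sigma$ the comparisons of the disjunct. Rules are instantiated over $\Gamma$. An interpretation $I$ is an *answer set* of a program $P$ if it is a minimal model of the set of the ground instances of rules of $P$ whose body is true in $I$. A *cautious consequence* of $P$ is a ground atom that is true in all answer sets of $P$. **Theorem.** Let $\mathcal D$ be a finite database for a schema $\mathcal G$ such that at least one of the following holds: - (i) $\mathcal G$ contains DCs only (no INDs); - (ii) $\mathcal G$ contains INDs only (no DCs); - (iii) $\mathcal G$ contains KDs and FKs only, and $\mathcal D$ is consistent with respect to the KDs; - (iv) $\mathcal G$ contains KDs and SFKs only. Let $q$ be a union of conjunctive queries over $\mathcal G$. Then, for every tuple $t$ over $\Gamma$ of the arity of $q$, $$t\in ans_{loosely\text{-}exact}(q,\mathcal G,\mathcal D)\iff q_{cqa}(t)\text{ is a cautious consequence of }\mathcal D\cup P_{cqa}.$$ -/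

import Mathlib

namespace CQA

/-! ### Relational databases, constraints and queries

`Γ` is the domain of values; variables are natural numbers. -/

/-- An atom `p(a₁, …, aₖ)`, `k = ar p`, with arguments in `T`
(`T = ℕ`: variables, `T = Γ`: values, i.e. a fact). -/
@[ext]
structure Atom {P : Type*} (ar : P → ℕ) (T : Type*) where
  pred : P
  args : Fin (ar pred) → T

/-- Replace every argument `a` by `f a`. -/
def Atom.map {P T T' : Type*} {ar : P → ℕ} (a : Atom ar T) (f : T → T') : Atom ar T' :=
  ⟨a.pred, fun i => f (a.args i)⟩

/-- The comparison operators `≤, ≥, <, >, ≠`. -/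
inductive CmpOp
  | le | ge | lt | gt | ne

def CmpOp.Holds {Γ : Type*} [LinearOrder Γ] : CmpOp → Γ → Γ → Prop
  | .le, a, b => a ≤ b
  | .ge, a, b => a ≥ b
  | .lt, a, b => a < b
  | .gt, a, b => a > b
  | .ne, a, b => a ≠ b

/-- A comparison atom. -/
structure Cmp (T : Type*) where
  op : CmpOp
  lhs : T
  rhs : T

/-- A conjunction `r₁(x₁) ∧ … ∧ rₘ(xₘ) ∧ σ(x₁, …, xₘ)`; the comparison atoms in `σ` only use
variables of the relational atoms. -/
structure Conj {R : Type*} (ar : R → ℕ) where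
  atoms : List (Atom ar ℕ)
  cmps : List (Cmp ℕ)
  safe : ∀ c ∈ cmps, (∃ a ∈ atoms, c.lhs ∈ Set.range a.args) ∧ (∃ a ∈ atoms, c.rhs ∈ Set.range a.args)

/-- The variable `x` occurs in a relational atom of the conjunction. -/
def Conj.Occurs {R : Type*} {ar : R → ℕ} (φ : Conj ar) (x : ℕ) : Prop :=
  ∃ a ∈ φ.atoms, x ∈ Set.range a.args

/-- The conjunction is true in the database `B` under the assignment `θ`. -/
def Conj.Holds {R Γ : Type*} [LinearOrder Γ] {ar : R → ℕ} (φ : Conj ar) (θ : ℕ → Γ)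
    (B : Set (Atom ar Γ)) : Prop :=
  (∀ a ∈ φ.atoms, a.map θ ∈ B) ∧ ∀ c ∈ φ.cmps, c.op.Holds (θ c.lhs) (θ c.rhs)

/-- A denial constraint `∀ x₁ … xₘ ¬[r₁(x₁) ∧ … ∧ rₘ(xₘ) ∧ σ]`, `m ≥ 1`. -/
structure DC {R : Type*} (ar : R → ℕ) where
  conj : Conj ar
  nonempty : conj.atoms ≠ []

def DC.Sat {R Γ : Type*} [LinearOrder Γ] {ar : R → ℕ} (c : DC ar) (B : Set (Atom ar Γ)) : Prop :=
  ∀ θ : ℕ → Γ, ¬ c.conj.Holds θ B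

/-- An inclusion dependency `r₁(x₁) → ∃ x₂∃ r₂(x₂)`. The variables of `x₁` are pairwise distinct, and
so are those of `x₂`; the variables that `x₁` and `x₂` share are the sequence `x∀`. -/
structure IND {R : Type*} (ar : R → ℕ) where
  lhs : Atom ar ℕ
  rhs : Atom ar ℕ
  lhs_inj : Function.Injective lhs.args
  rhs_inj : Function.Injective rhs.args

def IND.Sat {R Γ : Type*} {ar : R → ℕ} (d : IND ar) (B : Set (Atom ar Γ)) : Prop :=
  ∀ θ : ℕ → Γ, d.lhs.map θ ∈ B →
    ∃ θ' : ℕ → Γ, (∀ x ∈ Set.range d.lhs.args, θ' x = θ x) ∧ d.rhs.map θ' ∈ B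

/-- `π_L`: the positions of the shared variables in the left-hand atom. -/
def IND.leftIdx {R : Type*} {ar : R → ℕ} (d : IND ar) : Set (Fin (ar d.lhs.pred)) :=
  {i | d.lhs.args i ∈ Set.range d.rhs.args}

/-- `π_R`: the positions of the shared variables in the right-hand atom. -/
def IND.rightIdx {R : Type*} {ar : R → ℕ} (d : IND ar) : Set (Fin (ar d.rhs.pred)) :=
  {j | d.rhs.args j ∈ Set.range d.lhs.args}

/-- The sequence `x₂∃` of the variables of the right-hand atom that are not shared. -/
def IND.exVars {R : Type*} {ar : R → ℕ} (d : IND ar) : List ℕ :=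
  (List.ofFn d.rhs.args).filter (fun x => x ∉ List.ofFn d.lhs.args)

/-- A database schema: relation names with arities, and integrity constraints. -/
structure Schema where
  Rel : Type*
  arity : Rel → ℕ
  dcs : Set (DC arity)
  inds : Set (IND arity)

/-- Facts over a schema. A database is a set of facts. -/
abbrev Schema.Fact (G : Schema) (Γ : Type*) := Atom G.arity Γ

/-- The database satisfies all denial constraints of the schema. -/
def Schema.SatDCs {Γ : Type*} [LinearOrder Γ] (G : Schema) (B : Set (G.Fact Γ)) : Prop :=
  ∀ c ∈ G.dcs, c.Sat B

/-- The database satisfies all integrity constraints of the schema. -/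
def Schema.Consistent {Γ : Type*} [LinearOrder Γ] (G : Schema) (B : Set (G.Fact Γ)) : Prop :=
  G.SatDCs B ∧ ∀ d ∈ G.inds, d.Sat B

/-- A union of conjunctive queries `q(x) = cq₁(x) ∨ … ∨ cqₖ(x)` with answer variables
`x = (x₁, …, xₙ)`, pairwise distinct, all occurring in every disjunct; the other variables are
existentially quantified. -/
structure UCQ {R : Type*} (ar : R → ℕ) (n : ℕ) where
  free : Fin n → ℕ
  free_inj : Function.Injective free
  disjuncts : List (Conj ar)
  free_occurs : ∀ φ ∈ disjuncts, ∀ i, φ.Occurs (free i)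

/-- `ans(q, B)`. -/
def UCQ.ans {R Γ : Type*} [LinearOrder Γ] {ar : R → ℕ} {n : ℕ} (q : UCQ ar n)
    (B : Set (Atom ar Γ)) : Set (Fin n → Γ) :=
  {t | ∃ φ ∈ q.disjuncts, ∃ θ : ℕ → Γ, (∀ i, θ (q.free i) = t i) ∧ φ.Holds θ B}

/-! ### Loosely-exact repairs and consistent answers -/

/-- `B` is a loosely-exact repair for `D`: `B` is consistent, and no consistent database has a
strictly smaller symmetric difference with `D`. -/
def IsLooselyExactRepair {Γ : Type*} [LinearOrder Γ] (G : Schema) (D B : Set (G.Fact Γ)) : Prop :=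
  G.Consistent B ∧ ¬ ∃ B' : Set (G.Fact Γ), G.Consistent B' ∧ symmDiff B' D ⊂ symmDiff B D

/-- The consistent answers to `q` w.r.t. `D` under the loosely-exact semantics. -/
def looselyExactAns {Γ : Type*} [LinearOrder Γ] (G : Schema) {n : ℕ} (q : UCQ G.arity n)
    (D : Set (G.Fact Γ)) : Set (Fin n → Γ) :=
  {t | ∀ B : Set (G.Fact Γ), IsLooselyExactRepair G D B → t ∈ q.ans B}

/-! ### Key dependencies and foreign keys -/

/-- `c` is the denial constraint `∀ x₁ x₂ ¬(r(x₁) ∧ r(x₂) ∧ x₁ⁱ ≠ x₂ⁱ)` for the key `π` of `r`: no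
variable occurs twice in `x₁` or in `x₂`, and `x₁`, `x₂` share exactly the variables at the
positions in `π`. -/
def DC.IsKeyDC {R : Type*} {ar : R → ℕ} (c : DC ar) (r : R) (π : Set (Fin (ar r)))
    (i : Fin (ar r)) : Prop :=
  ∃ x₁ x₂ : Fin (ar r) → ℕ, Function.Injective x₁ ∧ Function.Injective x₂ ∧
    (∀ j k, x₁ j = x₂ k ↔ j = k ∧ j ∈ π) ∧
    c.conj.atoms = [⟨r, x₁⟩, ⟨r, x₂⟩] ∧ c.conj.cmps = [⟨CmpOp.ne, x₁ i, x₂ i⟩]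

/-- The denial constraints of the schema are exactly the key dependencies given by `key`, i.e. one
denial constraint for each relation name `r` and each position outside `key r`. In particular
`key r` consists of all positions if there is no denial constraint on `r`. -/
def Schema.KeysOnly (G : Schema) (key : ∀ r : G.Rel, Set (Fin (G.arity r))) : Prop :=
  (∀ c ∈ G.dcs, ∃ r, ∃ i ∉ key r, c.IsKeyDC r (key r) i) ∧
    ∀ r, ∀ i ∉ key r, ∃ c ∈ G.dcs, c.IsKeyDC r (key r) i

/-- Foreign key: `π_R = key(r₂)`. -/
def IND.IsFK {R : Type*} {ar : R → ℕ} (d : IND ar) (key : ∀ r : R, Set (Fin (ar r))) : Prop :=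
  d.rightIdx = key d.rhs.pred

/-- Safe foreign key: moreover `π_L ⊆ key(r₁)`. -/
def IND.IsSFK {R : Type*} {ar : R → ℕ} (d : IND ar) (key : ∀ r : R, Set (Fin (ar r))) : Prop :=
  d.IsFK key ∧ d.leftIdx ⊆ key d.lhs.pred

/-- There are DCs only. -/
def Schema.DCsOnly (G : Schema) : Prop := G.inds = ∅

/-- There are INDs only. -/
def Schema.INDsOnly (G : Schema) : Prop := G.dcs = ∅

/-- There are key dependencies (at most one for each relation name) and foreign keys only. -/
def Schema.KDsFKsOnly (G : Schema) : Prop :=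
  ∃ key, G.KeysOnly key ∧ ∀ d ∈ G.inds, d.IsFK key

/-- There are key dependencies (at most one for each relation name) and safe foreign keys only. -/
def Schema.KDsSFKsOnly (G : Schema) : Prop :=
  ∃ key, G.KeysOnly key ∧ ∀ d ∈ G.inds, d.IsSFK key

/-! ### Disjunctive logic programs with `#count`

Answer sets are those of Faber, Leone and Pfeifer: the reduct of `P` w.r.t. `I` consists of the
ground instances of rules of `P` whose body is true in `I`, and `I` is an answer set iff it is a
minimal model of that reduct. The constants of the language are the values in `Γ`. -/

inductive Term (Γ : Type*)
  | var (x : ℕ)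
  | const (c : Γ)

def Term.eval {Γ : Type*} (θ : ℕ → Γ) : Term Γ → Γ
  | .var x => θ x
  | .const c => c

/-- Body literals: `a`, `not a`, a comparison atom, and
`#count {X : a} = #count {X : b}` with local variables `X`. -/
inductive Literal {P : Type*} (ar : P → ℕ) (Γ : Type*)
  | pos (a : Atom ar (Term Γ))
  | naf (a : Atom ar (Term Γ))
  | cmp (c : Cmp (Term Γ))
  | countEq (X : List ℕ) (a b : Atom ar (Term Γ))

/-- The set of tuples denoted by `{X : a}` in the interpretation `I`, where the variables not in `X`
have been replaced according to `θ`. -/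
def tuples {P Γ : Type*} {ar : P → ℕ} (θ : ℕ → Γ) (I : Set (Atom ar Γ)) (X : List ℕ)
    (a : Atom ar (Term Γ)) : Set (List Γ) :=
  {v | ∃ θ' : ℕ → Γ, (∀ x ∉ X, θ' x = θ x) ∧ X.map θ' = v ∧ a.map (Term.eval θ') ∈ I}

/-- The literal, instantiated by `θ`, is true in the interpretation `I`. -/
def Literal.Holds {P Γ : Type*} [LinearOrder Γ] {ar : P → ℕ} (θ : ℕ → Γ) (I : Set (Atom ar Γ)) :
    Literal ar Γ → Prop
  | .pos a => a.map (Term.eval θ) ∈ I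
  | .naf a => a.map (Term.eval θ) ∉ I
  | .cmp c => c.op.Holds (c.lhs.eval θ) (c.rhs.eval θ)
  | .countEq X a b => (tuples θ I X a).encard = (tuples θ I X b).encard

/-- A rule `h₁ ∨ … ∨ hₖ ← l₁, …, lₘ`. -/
structure Rule {P : Type*} (ar : P → ℕ) (Γ : Type*) where
  head : List (Atom ar (Term Γ))
  body : List (Literal ar Γ)

def Rule.BodyTrue {P Γ : Type*} [LinearOrder Γ] {ar : P → ℕ} (r : Rule ar Γ) (θ : ℕ → Γ)
    (I : Set (Atom ar Γ)) : Prop :=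
  ∀ l ∈ r.body, l.Holds θ I

def Rule.HeadTrue {P Γ : Type*} {ar : P → ℕ} (r : Rule ar Γ) (θ : ℕ → Γ)
    (I : Set (Atom ar Γ)) : Prop :=
  ∃ h ∈ r.head, h.map (Term.eval θ) ∈ I

/-- `J` is a model of the reduct of the program `Pr` w.r.t. `I`. -/
def IsModelOfReduct {P Γ : Type*} [LinearOrder Γ] {ar : P → ℕ} (Pr : Set (Rule ar Γ))
    (I J : Set (Atom ar Γ)) : Prop :=
  ∀ r ∈ Pr, ∀ θ : ℕ → Γ, r.BodyTrue θ I → (r.BodyTrue θ J → r.HeadTrue θ J)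

def IsAnswerSet {P Γ : Type*} [LinearOrder Γ] {ar : P → ℕ} (Pr : Set (Rule ar Γ))
    (I : Set (Atom ar Γ)) : Prop :=
  Minimal (IsModelOfReduct Pr I) I

/-- The ground atom `a` is true in all answer sets. -/
def CautiousConsequence {P Γ : Type*} [LinearOrder Γ] {ar : P → ℕ} (Pr : Set (Rule ar Γ))
    (a : Atom ar Γ) : Prop :=
  ∀ I, IsAnswerSet Pr I → a ∈ I

/-! ### The encoding -/

/-- The predicates of the encoding: `g`, `gᶜ` (facts to be cancelled), `gʳ` (repaired relation) for
each relation name `g`, and the query predicate. -/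
inductive Pred (R : Type*)
  | base (g : R)
  | can (g : R)
  | rep (g : R)
  | query

/-- The arities of the predicates; `n` is the arity of the query. -/
def Pred.arity {R : Type*} (ar : R → ℕ) (n : ℕ) : Pred R → ℕ
  | .base g => ar g
  | .can g => ar g
  | .rep g => ar g
  | .query => n

section Encoding

variable {R : Type*} {ar : R → ℕ}

/-- `g(x)` as an atom of the program. -/
def baseAtom (Γ : Type*) (n : ℕ) (a : Atom ar ℕ) : Atom (Pred.arity ar n) (Term Γ) :=
  ⟨Pred.base a.pred, fun i => Term.var (a.args i)⟩

/-- `gᶜ(x)`. -/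
def canAtom (Γ : Type*) (n : ℕ) (a : Atom ar ℕ) : Atom (Pred.arity ar n) (Term Γ) :=
  ⟨Pred.can a.pred, fun i => Term.var (a.args i)⟩

/-- `gʳ(x)`. -/
def repAtom (Γ : Type*) (n : ℕ) (a : Atom ar ℕ) : Atom (Pred.arity ar n) (Term Γ) :=
  ⟨Pred.rep a.pred, fun i => Term.var (a.args i)⟩

/-- A comparison atom of a constraint or query, as a body literal. -/
def cmpLit {Γ : Type*} {n : ℕ} (c : Cmp ℕ) : Literal (Pred.arity ar n) Γ :=
  Literal.cmp ⟨c.op, Term.var c.lhs, Term.var c.rhs⟩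

/-- The fact `g(t)` as a rule with empty body. -/
def factRule {Γ : Type*} (n : ℕ) (f : Atom ar Γ) : Rule (Pred.arity ar n) Γ :=
  ⟨[⟨Pred.base f.pred, fun i => Term.const (f.args i)⟩], []⟩

/-- `g₁ᶜ(x₁) ∨ … ∨ gₘᶜ(xₘ) ← g₁(x₁), …, gₘ(xₘ), σ(x₁, …, xₘ).` -/
def dcRule (Γ : Type*) (n : ℕ) (c : DC ar) : Rule (Pred.arity ar n) Γ :=
  ⟨c.conj.atoms.map (canAtom Γ n),
    c.conj.atoms.map (fun a => Literal.pos (baseAtom Γ n a)) ++ c.conj.cmps.map cmpLit⟩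

/-- If `|x₂∃| > 0`: `g₁ᶜ(x₁) ← g₁(x₁), #count {x₂∃ : g₂ᶜ(x₂)} = #count {x₂∃ : g₂(x₂)}.`
If `|x₂∃| = 0`: `g₁ᶜ(x₁) ← g₁(x₁), g₂ᶜ(x₂).` and `g₁ᶜ(x₁) ← g₁(x₁), not g₂(x₂).` -/
def indRules (Γ : Type*) (n : ℕ) (d : IND ar) : Set (Rule (Pred.arity ar n) Γ) :=
  if 0 < d.exVars.length then
    {⟨[canAtom Γ n d.lhs], [Literal.pos (baseAtom Γ n d.lhs),
      Literal.countEq d.exVars (canAtom Γ n d.rhs) (baseAtom Γ n d.rhs)]⟩}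
  else
    {⟨[canAtom Γ n d.lhs], [Literal.pos (baseAtom Γ n d.lhs), Literal.pos (canAtom Γ n d.rhs)]⟩,
     ⟨[canAtom Γ n d.lhs], [Literal.pos (baseAtom Γ n d.lhs), Literal.naf (baseAtom Γ n d.rhs)]⟩}

/-- The atom `g(X₀, …, Xₖ₋₁)` with distinct variables. -/
def genericAtom (ar : R → ℕ) (g : R) : Atom ar ℕ := ⟨g, fun i => i⟩

/-- `gʳ(x) ← g(x), not gᶜ(x).` -/
def repRule (Γ : Type*) (ar : R → ℕ) (n : ℕ) (g : R) : Rule (Pred.arity ar n) Γ :=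
  ⟨[repAtom Γ n (genericAtom ar g)],
    [Literal.pos (baseAtom Γ n (genericAtom ar g)), Literal.naf (canAtom Γ n (genericAtom ar g))]⟩

/-- The rule `q(x) ← g₁ʳ(y₁), …, gₘʳ(yₘ), σ.` for a disjunct of a query with answer variables
`x`. -/
def queryRule (Γ : Type*) {n : ℕ} (x : Fin n → ℕ) (φ : Conj ar) : Rule (Pred.arity ar n) Γ :=
  ⟨[⟨Pred.query, fun i => Term.var (x i)⟩],
    φ.atoms.map (fun a => Literal.pos (repAtom Γ n a)) ++ φ.cmps.map cmpLit⟩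

end Encoding

/-- The program `P_cqa` for the schema `G` and the query `q` (loosely-exact semantics); it contains
the rules that define the query predicate. -/
def Pcqa (Γ : Type*) (G : Schema) {n : ℕ} (q : UCQ G.arity n) :
    Set (Rule (Pred.arity G.arity n) Γ) :=
  {r | ∃ c ∈ G.dcs, r = dcRule Γ n c} ∪
  {r | ∃ d ∈ G.inds, r ∈ indRules Γ n d} ∪
  {r | ∃ g : G.Rel, r = repRule Γ G.arity n g} ∪
  {r | ∃ φ ∈ q.disjuncts, r = queryRule Γ q.free φ}

/-- The database `D` as a set of rules with empty body. -/
def factRules {Γ : Type*} (G : Schema) (n : ℕ) (D : Set (G.Fact Γ)) :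
    Set (Rule (Pred.arity G.arity n) Γ) :=
  factRule n '' D

/-- The ground query atom `q(t)`. -/
def queryAtom {R Γ : Type*} (ar : R → ℕ) {n : ℕ} (t : Fin n → Γ) : Atom (Pred.arity ar n) Γ :=
  ⟨Pred.query, t⟩

end CQA

/-! Both sides are compared with one intermediate condition: `t` is an answer in every maximal
consistent subset `M` of `D`.

For repairs (`mem_looselyExactAns_iff`), every such `M` is a loosely-exact repair, for any schema.
Conversely, in each of the four cases every repair contains some such `M`; since UCQs are monotone,
an answer in `M` persists in the repair. The containment comes from a competitor argument: were `M`
not inside the repair `B`, some consistent database containing `M` would insert nothing more and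
delete strictly less than `B`.

For the program (`cautiousConsequence_queryAtom_iff`), the answer sets are exactly the
interpretations with base facts `D`, cancelled facts `D \ M`, repaired facts `M` and query answers
`q.ans M`. The constraint rules say that the uncancelled part of `D` is consistent, and minimizing
cancellations is maximizing `M`. Finiteness of `D` makes equality of counts equivalent to equality
of the counted sets. -/

namespace CQA

/-! ### Inclusion dependencies and key conflicts -/

section Repairs

variable {R Γ : Type*} {ar : R → ℕ}

/-- A right-hand fact witnesses an inclusion dependency iff it agrees with the assignment on the
shared positions. -/
theorem IND.exists_extension (d : IND ar) (θ : ℕ → Γ) (a : Fin (ar d.rhs.pred) → Γ)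
    (ha : ∀ j ∈ d.rightIdx, a j = θ (d.rhs.args j)) :
    ∃ θ' : ℕ → Γ, (∀ x ∉ d.exVars, θ' x = θ x) ∧ ∀ j, θ' (d.rhs.args j) = a j := by
  classical
  refine ⟨fun x => if h : ∃ j, d.rhs.args j = x then a h.choose else θ x, ?_, ?_⟩
  · intro x hx
    by_cases h : ∃ j, d.rhs.args j = x
    · simp only [h, dite_true]
      have hj := h.choose_spec
      rw [ha _ ?_, hj]
      by_contra hc
      apply hx
      simp only [IND.exVars, List.mem_filter, List.mem_ofFn, decide_eq_true_eq]
      refine ⟨h, fun hl => hc ?_⟩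
      simpa [IND.rightIdx, hj] using hl
    · simp [h]
  · intro j
    have h : ∃ k, d.rhs.args k = d.rhs.args j := ⟨j, rfl⟩
    simp only [h, dite_true]
    rw [d.rhs_inj h.choose_spec]

theorem IND.mem_exVars {d : IND ar} {x : ℕ} :
    x ∈ d.exVars ↔ x ∈ Set.range d.rhs.args ∧ x ∉ Set.range d.lhs.args := by
  simp [IND.exVars, List.mem_filter, List.mem_ofFn]

/-- Trades extensions of assignments for facts. The variables of the right-hand atom are distinct,
so any fact agreeing with `θ` on the shared positions is an instance of it under some extension. -/
theorem IND.sat_iff (d : IND ar) (B : Set (Atom ar Γ)) :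
    d.Sat B ↔ ∀ θ : ℕ → Γ, d.lhs.map θ ∈ B →
      ∃ a, (⟨d.rhs.pred, a⟩ : Atom ar Γ) ∈ B ∧ ∀ j ∈ d.rightIdx, a j = θ (d.rhs.args j) := by
  constructor
  · intro h θ hθ
    obtain ⟨θ', h1, h2⟩ := h θ hθ
    exact ⟨_, h2, fun j hj => h1 _ hj⟩
  · intro h θ hθ
    obtain ⟨a, ha, hj⟩ := h θ hθ
    obtain ⟨θ', h1, h2⟩ := d.exists_extension θ a hj
    refine ⟨θ', fun x hx => h1 x fun hc => (IND.mem_exVars.1 hc).2 hx, ?_⟩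
    have : d.rhs.map θ' = ⟨d.rhs.pred, a⟩ := by
      simp only [Atom.map, Atom.mk.injEq, heq_eq_eq, true_and]
      exact funext h2
    rwa [this]

theorem IND.sat_union {d : IND ar} {A B : Set (Atom ar Γ)} (hA : d.Sat A) (hB : d.Sat B) :
    d.Sat (A ∪ B) := by
  rintro θ (h | h)
  · obtain ⟨θ', h1, h2⟩ := hA θ h
    exact ⟨θ', h1, Or.inl h2⟩
  · obtain ⟨θ', h1, h2⟩ := hB θ h
    exact ⟨θ', h1, Or.inr h2⟩

/-- Facts of the same relation that agree on its key. -/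
def SameKey (key : ∀ r : R, Set (Fin (ar r))) (f g : Atom ar Γ) : Prop :=
  ∃ (r : R) (a b : Fin (ar r) → Γ), f = ⟨r, a⟩ ∧ g = ⟨r, b⟩ ∧ ∀ i ∈ key r, a i = b i

theorem SameKey.symm {key : ∀ r : R, Set (Fin (ar r))} {f g : Atom ar Γ} (h : SameKey key f g) :
    SameKey key g f := by
  obtain ⟨r, a, b, hf, hg, hab⟩ := h
  exact ⟨r, b, a, hg, hf, fun i hi => (hab i hi).symm⟩

theorem SameKey.trans {key : ∀ r : R, Set (Fin (ar r))} {f g h : Atom ar Γ}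
    (h1 : SameKey key f g) (h2 : SameKey key g h) : SameKey key f h := by
  obtain ⟨r, a, b, rfl, rfl, hab⟩ := h1
  obtain ⟨r', b', c, hb, rfl, hbc⟩ := h2
  obtain ⟨rfl, hb⟩ := Atom.mk.inj hb
  obtain rfl := eq_of_heq hb
  exact ⟨r, a, c, rfl, rfl, fun i hi => (hab i hi).trans (hbc i hi)⟩

variable [LinearOrder Γ]

theorem Conj.Holds.mono {φ : Conj ar} {θ : ℕ → Γ} {A B : Set (Atom ar Γ)} (hAB : A ⊆ B)
    (h : φ.Holds θ A) : φ.Holds θ B :=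
  ⟨fun a ha => hAB (h.1 a ha), h.2⟩

theorem UCQ.ans_mono {n : ℕ} (q : UCQ ar n) {A B : Set (Atom ar Γ)} (hAB : A ⊆ B) :
    q.ans A ⊆ q.ans B := by
  rintro t ⟨φ, hφ, θ, ht, h⟩
  exact ⟨φ, hφ, θ, ht, h.mono hAB⟩

theorem Schema.SatDCs.anti {G : Schema} {A B : Set (G.Fact Γ)} (hAB : A ⊆ B) (h : G.SatDCs B) :
    G.SatDCs A :=
  fun c hc θ hθ => h c hc θ (hθ.mono hAB)

/-! ### Maximal consistent subsets and loosely-exact repairs -/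

/-- `M` is a maximal consistent subset of `D`. -/
def IsMaxConsistentSubset (G : Schema) (D M : Set (G.Fact Γ)) : Prop :=
  Maximal (fun M => M ⊆ D ∧ G.Consistent M) M

theorem Schema.consistent_empty (G : Schema) : G.Consistent (∅ : Set (G.Fact Γ)) := by
  refine ⟨fun c _ θ h => ?_, fun d _ θ h => h.elim⟩
  obtain ⟨a, ha⟩ := List.exists_mem_of_ne_nil _ c.nonempty
  exact h.1 a ha

/-- Since `M ⊆ D`, a database at least as close to `D` inserts nothing and deletes only facts
outside `M`. It therefore lies between `M` and `D`, and maximality makes it equal to `M`. -/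
theorem IsMaxConsistentSubset.isLooselyExactRepair {G : Schema} {D M : Set (G.Fact Γ)}
    (hM : IsMaxConsistentSubset G D M) : IsLooselyExactRepair G D M := by
  refine ⟨hM.prop.2, ?_⟩
  rintro ⟨B, hB, hlt⟩
  have hBD : B ⊆ D := by
    intro x hx
    by_contra hxD
    rcases hlt.1 (Or.inl ⟨hx, hxD⟩ : x ∈ symmDiff B D) with h | h
    · exact hxD (hM.prop.1 h.1)
    · exact hxD h.1
  have hMB : M ⊆ B := by
    intro x hx
    by_contra hxB
    rcases hlt.1 (Or.inr ⟨hM.prop.1 hx, hxB⟩ : x ∈ symmDiff B D) with h | h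
    · exact h.2 (hM.prop.1 hx)
    · exact h.2 hx
  have : B = M := (hM.eq_of_subset ⟨hBD, hB⟩ hMB).symm
  exact hlt.ne (by rw [this])

/-- A repair contains every `M ⊆ D` that can be brought into it by a consistent database that inserts
no more and deletes no more than the repair. -/
theorem IsLooselyExactRepair.subset_of_consistent {G : Schema} {D B B' M : Set (G.Fact Γ)}
    (hB : IsLooselyExactRepair G D B) (hM : M ⊆ D) (hB' : G.Consistent B') (hMB' : M ⊆ B')
    (h1 : B' ⊆ B ∪ D) (h2 : B ∩ D ⊆ B') : M ⊆ B := by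
  by_contra hne
  obtain ⟨x, hx, hxB⟩ := Set.not_subset.1 hne
  refine hB.2 ⟨B', hB', ?_, ?_⟩
  · rintro y (⟨hy, hyD⟩ | ⟨hyD, hy⟩)
    · exact Or.inl ⟨(h1 hy).resolve_right hyD, hyD⟩
    · exact Or.inr ⟨hyD, fun hyB => hy (h2 ⟨hyB, hyD⟩)⟩
  · intro hle
    rcases hle (Or.inr ⟨hM hx, hxB⟩ : x ∈ symmDiff B D) with h | h
    · exact h.2 (hM hx)
    · exact h.2 (hMB' hx)

theorem Schema.KeysOnly.satDCs_iff {G : Schema} {key : ∀ r : G.Rel, Set (Fin (G.arity r))}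
    (hG : G.KeysOnly key) (B : Set (G.Fact Γ)) :
    G.SatDCs B ↔ ∀ f ∈ B, ∀ g ∈ B, SameKey key f g → f = g := by
  classical
  constructor
  · rintro h _ hf _ hg ⟨r, a, b, rfl, rfl, hab⟩
    by_contra hne
    obtain ⟨i, hi⟩ : ∃ i, a i ≠ b i := by
      by_contra! hc
      exact hne (by rw [funext hc])
    obtain ⟨c, hc, x₁, x₂, h1, h2, h12, hatoms, hcmps⟩ := hG.2 r i (fun hk => hi (hab i hk))
    -- A variable shared by `x₁` and `x₂` takes its value from `a`; this is harmless because such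
    -- variables sit at key positions, where `a` and `b` agree. The default `a i` is just some
    -- element of `Γ`.
    let θ : ℕ → Γ := fun x => if h : ∃ j, x₁ j = x then a h.choose
      else if h : ∃ j, x₂ j = x then b h.choose else a i
    have hθ1 : ∀ j, θ (x₁ j) = a j := by
      intro j
      have h : ∃ k, x₁ k = x₁ j := ⟨j, rfl⟩
      simp only [θ, h, dite_true]
      rw [h1 h.choose_spec]
    have hθ2 : ∀ j, θ (x₂ j) = b j := by
      intro j
      by_cases h : ∃ k, x₁ k = x₂ j
      · obtain ⟨k, hk⟩ := h
        obtain ⟨rfl, hkey⟩ := (h12 k j).1 hk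
        rw [← hk, hθ1, hab _ hkey]
      · have h' : ∃ k, x₂ k = x₂ j := ⟨j, rfl⟩
        simp only [θ, h, h', dite_true, dite_false]
        rw [h2 h'.choose_spec]
    refine h c hc θ ⟨?_, ?_⟩
    · rw [hatoms]
      intro u hu
      simp only [List.mem_cons, List.not_mem_nil, or_false] at hu
      rcases hu with rfl | rfl
      · simpa only [Atom.map, hθ1] using hf
      · simpa only [Atom.map, hθ2] using hg
    · rw [hcmps]
      intro u hu
      simp only [List.mem_cons, List.not_mem_nil, or_false] at hu
      subst hu
      simpa only [CmpOp.Holds, hθ1, hθ2] using hi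
  · intro h c hc θ hθ
    obtain ⟨r, i, -, x₁, x₂, h1, h2, h12, hatoms, hcmps⟩ := hG.1 c hc
    have hx1 := hθ.1 ⟨r, x₁⟩ (by simp [hatoms])
    have hx2 := hθ.1 ⟨r, x₂⟩ (by simp [hatoms])
    have hne := hθ.2 ⟨CmpOp.ne, x₁ i, x₂ i⟩ (by simp [hcmps])
    have heq := h _ hx1 _ hx2
      ⟨r, _, _, rfl, rfl, fun j hj => congrArg θ ((h12 j j).2 ⟨rfl, hj⟩)⟩
    simp only [Atom.map, Atom.mk.injEq, heq_eq_eq, true_and] at heq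
    exact hne (congrFun heq i)

/-- With keys and foreign keys, a consistent `M ⊆ D` that agrees with the repair `B` on the facts of
`B ∩ D` competing with `M` is contained in `B`: replace the facts of `B` that compete with `M`. -/
theorem IsLooselyExactRepair.subset_of_foreignKeys {G : Schema}
    {key : ∀ r : G.Rel, Set (Fin (G.arity r))} (hG : G.KeysOnly key)
    (hFK : ∀ d ∈ G.inds, d.IsFK key) {D B M : Set (G.Fact Γ)}
    (hB : IsLooselyExactRepair G D B) (hM : M ⊆ D) (hMc : G.Consistent M)
    (hBM : ∀ f ∈ B, f ∈ D → ∀ m ∈ M, SameKey key f m → f = m) : M ⊆ B := by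
  refine hB.subset_of_consistent (B' := M ∪ {b ∈ B | ∀ m ∈ M, SameKey key b m → b = m}) hM
    ⟨?_, ?_⟩ Set.subset_union_left ?_ ?_
  · rw [hG.satDCs_iff]
    have hM' := (hG.satDCs_iff M).1 hMc.1
    have hB' := (hG.satDCs_iff B).1 hB.1.1
    rintro f (hf | hf) g (hg | hg) hfg
    · exact hM' f hf g hg hfg
    · exact (hg.2 f hf hfg.symm).symm
    · exact hf.2 g hg hfg
    · exact hB' f hf.1 g hg.1 hfg
  · intro d hd
    rw [IND.sat_iff]
    rintro θ (h | h)
    · obtain ⟨a, ha, hj⟩ := (d.sat_iff M).1 (hMc.2 d hd) θ h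
      exact ⟨a, Or.inl ha, hj⟩
    · obtain ⟨a, ha, hj⟩ := (d.sat_iff B).1 (hB.1.2 d hd) θ h.1
      -- If the witness taken from `B` competes with a fact of `M`, that fact replaces it: `π_R` is
      -- the key, so both agree on all shared positions.
      by_cases hc : ∃ m ∈ M, SameKey key ⟨d.rhs.pred, a⟩ m
      · obtain ⟨_, hm, r, a', b, h1, rfl, hab⟩ := hc
        obtain ⟨rfl, h1⟩ := Atom.mk.inj h1
        obtain rfl := eq_of_heq h1
        refine ⟨b, Or.inl hm, fun j hjr => ?_⟩
        rw [← hab j ((hFK d hd) ▸ hjr), hj j hjr]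
      · exact ⟨a, Or.inr ⟨ha, fun m hm hs => (hc ⟨m, hm, hs⟩).elim⟩, hj⟩
  · rintro x (hx | hx)
    · exact Or.inr (hM hx)
    · exact Or.inl hx.1
  · rintro x ⟨hxB, hxD⟩
    exact Or.inr ⟨hxB, hBM x hxB hxD⟩

/-- With keys and safe foreign keys, a fact of a consistent database may be exchanged for one with
the same key. -/
theorem Schema.Consistent.exchange {G : Schema} {key : ∀ r : G.Rel, Set (Fin (G.arity r))}
    (hG : G.KeysOnly key) (hSFK : ∀ d ∈ G.inds, d.IsSFK key) {M : Set (G.Fact Γ)}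
    (hM : G.Consistent M) {m f : G.Fact Γ} (hm : m ∈ M) (hfm : SameKey key f m) :
    G.Consistent (insert f (M \ {m})) := by
  have hM' := (hG.satDCs_iff M).1 hM.1
  refine ⟨?_, fun d hd => ?_⟩
  · rw [hG.satDCs_iff]
    rintro x (rfl | hx) y (rfl | hy) hxy
    · rfl
    · exact (hy.2 (hM' _ hy.1 _ hm (hxy.symm.trans hfm))).elim
    · exact (hx.2 (hM' _ hx.1 _ hm (hxy.trans hfm))).elim
    · exact hM' _ hx.1 _ hy.1 hxy
  · rw [IND.sat_iff]
    have hMd := (d.sat_iff M).1 (hM.2 d hd)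
    obtain ⟨hFK, hleft⟩ := hSFK d hd
    -- Witnesses survive the exchange: if the witness was `m`, then `f` serves instead, having the
    -- same key `π_R`.
    have key_step : ∀ θ : ℕ → Γ, (∃ a, (⟨d.rhs.pred, a⟩ : G.Fact Γ) ∈ M ∧
        ∀ j ∈ d.rightIdx, a j = θ (d.rhs.args j)) →
        ∃ a, (⟨d.rhs.pred, a⟩ : G.Fact Γ) ∈ insert f (M \ {m}) ∧
          ∀ j ∈ d.rightIdx, a j = θ (d.rhs.args j) := by
      rintro θ ⟨a, ha, hj⟩
      by_cases hc : (⟨d.rhs.pred, a⟩ : G.Fact Γ) = m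
      · subst hc
        obtain ⟨r, b, a', rfl, h1, hab⟩ := hfm
        obtain ⟨rfl, h1⟩ := Atom.mk.inj h1
        obtain rfl := eq_of_heq h1
        refine ⟨b, Or.inl rfl, fun j hjr => ?_⟩
        rw [hab j (hFK ▸ hjr), hj j hjr]
      · exact ⟨a, Or.inr ⟨ha, hc⟩, hj⟩
    rintro θ (h | h)
    · apply key_step
      obtain ⟨r, b, a', rfl, rfl, hab⟩ := hfm
      obtain ⟨rfl, h1⟩ := Atom.mk.inj h
      obtain rfl := eq_of_heq h1
      classical
      -- Safety enters here. The demand made by `f` on the left is the one already made by `m`,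
      -- since the shared positions lie in the key; `θm` instantiates the left-hand atom to `m`.
      let θm : ℕ → Γ := fun x => if h : ∃ i, d.lhs.args i = x then a' h.choose else θ x
      have hθm : ∀ i, θm (d.lhs.args i) = a' i := by
        intro i
        have h : ∃ k, d.lhs.args k = d.lhs.args i := ⟨i, rfl⟩
        simp only [θm, h, dite_true]
        rw [d.lhs_inj h.choose_spec]
      obtain ⟨a, ha, hj⟩ := hMd θm (by simpa only [Atom.map, hθm] using hm)
      refine ⟨a, ha, fun j hjr => ?_⟩
      rw [hj j hjr]
      obtain ⟨i, hi⟩ := hjr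
      rw [← hi, hθm, ← hab i (hleft ⟨j, hi.symm⟩)]
    · exact key_step θ (hMd θ h.1)

theorem exists_isMaxConsistentSubset (G : Schema) {D : Set (G.Fact Γ)} (hD : D.Finite) :
    ∃ M, IsMaxConsistentSubset G D M := by
  have hfin : {M : Set (G.Fact Γ) | M ⊆ D ∧ G.Consistent M}.Finite :=
    hD.finite_subsets.subset fun M hM => hM.1
  obtain ⟨M, hM⟩ := hfin.exists_maximal ⟨∅, Set.empty_subset _, G.consistent_empty⟩
  exact ⟨M, hM⟩

/-- Among consistent subsets of `D`, choose one maximizing `M.ncard + (M ∩ B).ncard`. The sum gives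
maximality under inclusion, both terms being monotone. It also excludes key conflicts with `B ∩ D`:
exchanging a fact of `M` for a competing one of `B` keeps the first term and raises the second. -/
theorem IsLooselyExactRepair.exists_subset_of_safeForeignKeys {G : Schema}
    (hG : G.KDsSFKsOnly) {D B : Set (G.Fact Γ)} (hD : D.Finite)
    (hB : IsLooselyExactRepair G D B) : ∃ M, IsMaxConsistentSubset G D M ∧ M ⊆ B := by
  obtain ⟨key, hkey, hSFK⟩ := hG
  have hfin : {M : Set (G.Fact Γ) | M ⊆ D ∧ G.Consistent M}.Finite :=
    hD.finite_subsets.subset fun M hM => hM.1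
  obtain ⟨M, ⟨hMD, hMc⟩, hmax⟩ := Set.exists_max_image _
    (fun M : Set (G.Fact Γ) => M.ncard + (M ∩ B).ncard) hfin
    ⟨∅, Set.empty_subset _, G.consistent_empty⟩
  refine ⟨M, ⟨⟨hMD, hMc⟩, fun M' hM' hle => ?_⟩, ?_⟩
  · have h := hmax M' hM'
    have hf := hD.subset hM'.1
    have h1 : (M ∩ B).ncard ≤ (M' ∩ B).ncard :=
      Set.ncard_le_ncard (Set.inter_subset_inter_left _ hle) (hf.inter_of_left _)
    exact (Set.eq_of_subset_of_ncard_le hle (by omega) hf).ge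
  · refine hB.subset_of_foreignKeys hkey (fun d hd => (hSFK d hd).1) hMD hMc ?_
    intro f hfB hfD m hm hfm
    by_contra hne
    have hmB : m ∉ B := fun hmB => hne ((hkey.satDCs_iff B).1 hB.1.1 f hfB m hmB hfm)
    have hfM : f ∉ M := fun hfM => hne ((hkey.satDCs_iff M).1 hMc.1 f hfM m hm hfm)
    have hMf := hD.subset hMD
    have h := hmax (insert f (M \ {m}))
      ⟨Set.insert_subset hfD (Set.sdiff_subset.trans hMD), hMc.exchange hkey hSFK hm hfm⟩
    have h1 : (insert f (M \ {m})).ncard = M.ncard := Set.ncard_exchange hfM hm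
    have h2 : insert f (M \ {m}) ∩ B = insert f (M ∩ B) := by
      ext x
      simp only [Set.mem_inter_iff, Set.mem_insert_iff, Set.mem_sdiff, Set.mem_singleton_iff]
      constructor
      · rintro ⟨rfl | hx, hxB⟩
        · exact Or.inl rfl
        · exact Or.inr ⟨hx.1, hxB⟩
      · rintro (rfl | ⟨hx, hxB⟩)
        · exact ⟨Or.inl rfl, hfB⟩
        · exact ⟨Or.inr ⟨hx, fun hxm => hmB (hxm ▸ hxB)⟩, hxB⟩
    have h3 := Set.ncard_insert_of_notMem (fun hf : f ∈ M ∩ B => hfM hf.1)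
      (hMf.inter_of_left B)
    simp only [h1, h2, h3] at h
    omega

theorem IsLooselyExactRepair.exists_isMaxConsistentSubset {G : Schema} {D B : Set (G.Fact Γ)}
    (hD : D.Finite)
    (hG : G.DCsOnly ∨ G.INDsOnly ∨ (G.KDsFKsOnly ∧ G.SatDCs D) ∨ G.KDsSFKsOnly)
    (hB : IsLooselyExactRepair G D B) : ∃ M, IsMaxConsistentSubset G D M ∧ M ⊆ B := by
  rcases hG with hG | hG | ⟨⟨key, hkey, hFK⟩, hDs⟩ | hG
  -- DCs only: subsets of consistent databases are consistent, so `B ∩ D` itself is the required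
  -- subset.
  · have hind : ∀ A : Set (G.Fact Γ), ∀ d ∈ G.inds, d.Sat A := by
      intro A d hd
      rw [Schema.DCsOnly] at hG
      simp [hG] at hd
    refine ⟨B ∩ D, ⟨⟨Set.inter_subset_right, hB.1.1.anti Set.inter_subset_left, hind _⟩, ?_⟩,
      Set.inter_subset_left⟩
    rintro M ⟨hMD, hM⟩ hle
    exact Set.subset_inter
      (hB.subset_of_consistent hMD hM le_rfl (hMD.trans Set.subset_union_right) hle) hMD
  -- INDs only: INDs are preserved by unions, so `M ∪ B` is a consistent competitor of `B`, for any
  -- `M`.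
  · obtain ⟨M, hM⟩ := CQA.exists_isMaxConsistentSubset G hD
    refine ⟨M, hM, hB.subset_of_consistent (B' := M ∪ B) hM.prop.1 ⟨?_, ?_⟩
      Set.subset_union_left ?_ ?_⟩
    · intro c hc
      rw [Schema.INDsOnly] at hG
      simp [hG] at hc
    · exact fun d hd => IND.sat_union (hM.prop.2.2 d hd) (hB.1.2 d hd)
    · exact Set.union_subset (hM.prop.1.trans Set.subset_union_right) Set.subset_union_left
    · exact Set.inter_subset_left.trans Set.subset_union_right
  -- Two facts of `D` never conflict on a key here, so any `M` meets the condition on competing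
  -- facts.
  · obtain ⟨M, hM⟩ := CQA.exists_isMaxConsistentSubset G hD
    refine ⟨M, hM, hB.subset_of_foreignKeys hkey hFK hM.prop.1 hM.prop.2 ?_⟩
    exact fun f _ hfD m hm => (hkey.satDCs_iff D).1 hDs f hfD m (hM.prop.1 hm)
  · exact hB.exists_subset_of_safeForeignKeys hG hD

theorem mem_looselyExactAns_iff {G : Schema} {D : Set (G.Fact Γ)} (hD : D.Finite)
    (hG : G.DCsOnly ∨ G.INDsOnly ∨ (G.KDsFKsOnly ∧ G.SatDCs D) ∨ G.KDsSFKsOnly)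
    {n : ℕ} (q : UCQ G.arity n) (t : Fin n → Γ) :
    t ∈ looselyExactAns G q D ↔ ∀ M, IsMaxConsistentSubset G D M → t ∈ q.ans M := by
  constructor
  · exact fun h M hM => h M hM.isLooselyExactRepair
  · intro h B hB
    obtain ⟨M, hM, hMB⟩ := hB.exists_isMaxConsistentSubset hD hG
    exact q.ans_mono hMB (h M hM)

end Repairs

/-! ### Interpretations of the program and the meaning of its rules -/

section AnswerSets

variable {R Γ : Type*} {ar : R → ℕ} {n : ℕ}

/-- The interpretation with base facts `A`, cancelled facts `C`, repaired facts `S` and query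
answers `Q`. -/
def interp (A C S : Set (Atom ar Γ)) (Q : Set (Fin n → Γ)) : Set (Atom (Pred.arity ar n) Γ) :=
  {a | match a with
    | ⟨.base g, x⟩ => (⟨g, x⟩ : Atom ar Γ) ∈ A
    | ⟨.can g, x⟩ => (⟨g, x⟩ : Atom ar Γ) ∈ C
    | ⟨.rep g, x⟩ => (⟨g, x⟩ : Atom ar Γ) ∈ S
    | ⟨.query, x⟩ => x ∈ Q}

theorem exists_eq_interp (I : Set (Atom (Pred.arity ar n) Γ)) :
    ∃ A C S Q, I = interp A C S Q := by
  refine ⟨{f | ⟨.base f.pred, f.args⟩ ∈ I}, {f | ⟨.can f.pred, f.args⟩ ∈ I},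
    {f | ⟨.rep f.pred, f.args⟩ ∈ I}, {x | ⟨.query, x⟩ ∈ I}, ?_⟩
  ext ⟨g | g | g | _, x⟩ <;> exact Iff.rfl

theorem interp_subset_interp {A C S A' C' S' : Set (Atom ar Γ)} {Q Q' : Set (Fin n → Γ)} :
    interp A C S Q ⊆ interp A' C' S' Q' ↔ A ⊆ A' ∧ C ⊆ C' ∧ S ⊆ S' ∧ Q ⊆ Q' := by
  constructor
  · intro h
    exact ⟨fun f hf => h (show (⟨.base f.pred, f.args⟩ : Atom (Pred.arity ar n) Γ) ∈ _ from hf),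
      fun f hf => h (show (⟨.can f.pred, f.args⟩ : Atom (Pred.arity ar n) Γ) ∈ _ from hf),
      fun f hf => h (show (⟨.rep f.pred, f.args⟩ : Atom (Pred.arity ar n) Γ) ∈ _ from hf),
      fun x hx => h (show (⟨.query, x⟩ : Atom (Pred.arity ar n) Γ) ∈ _ from hx)⟩
  · rintro ⟨h1, h2, h3, h4⟩ ⟨g | g | g | _, x⟩ hx
    exacts [h1 hx, h2 hx, h3 hx, h4 hx]

/-- Every fact of `A` that witnesses the dependency `d` under `θ` belongs to `C`. -/
def IND.Blocked (d : IND ar) (θ : ℕ → Γ) (A C : Set (Atom ar Γ)) : Prop :=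
  ∀ a, (∀ j ∈ d.rightIdx, a j = θ (d.rhs.args j)) →
    (⟨d.rhs.pred, a⟩ : Atom ar Γ) ∈ A → (⟨d.rhs.pred, a⟩ : Atom ar Γ) ∈ C

/-- The contrapositive has the shape of the program's IND rules: a fact whose witnesses are all
cancelled or absent must be cancelled. -/
theorem IND.sat_diff_iff (d : IND ar) (A C : Set (Atom ar Γ)) :
    d.Sat (A \ C) ↔ ∀ θ : ℕ → Γ, d.lhs.map θ ∈ A → d.Blocked θ A C → d.lhs.map θ ∈ C := by
  rw [IND.sat_iff]
  constructor
  · intro h θ hA hb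
    by_contra hC
    obtain ⟨a, ha, hj⟩ := h θ ⟨hA, hC⟩
    exact ha.2 (hb a hj ha.1)
  · rintro h θ ⟨hA, hC⟩
    by_contra! hc
    refine hC (h θ hA fun a hj ha => ?_)
    by_contra haC
    obtain ⟨j, hjr, hne⟩ := hc a ⟨ha, haC⟩
    exact hne (hj j hjr)

theorem IND.Blocked.mono {d : IND ar} {θ : ℕ → Γ} {A C C' : Set (Atom ar Γ)} (hC : C ⊆ C')
    (h : d.Blocked θ A C) : d.Blocked θ A C' :=
  fun a hj ha => hC (h a hj ha)

theorem mem_tuples_canAtom {d : IND ar} {θ : ℕ → Γ} {A C S : Set (Atom ar Γ)}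
    {Q : Set (Fin n → Γ)} {v : List Γ} :
    v ∈ tuples θ (interp A C S Q) d.exVars (canAtom Γ n d.rhs) ↔
      ∃ θ' : ℕ → Γ, (∀ x ∉ d.exVars, θ' x = θ x) ∧ d.exVars.map θ' = v ∧ d.rhs.map θ' ∈ C :=
  Iff.rfl

theorem mem_tuples_baseAtom {d : IND ar} {θ : ℕ → Γ} {A C S : Set (Atom ar Γ)}
    {Q : Set (Fin n → Γ)} {v : List Γ} :
    v ∈ tuples θ (interp A C S Q) d.exVars (baseAtom Γ n d.rhs) ↔
      ∃ θ' : ℕ → Γ, (∀ x ∉ d.exVars, θ' x = θ x) ∧ d.exVars.map θ' = v ∧ d.rhs.map θ' ∈ A :=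
  Iff.rfl

theorem IND.not_mem_exVars_of_mem_rightIdx {d : IND ar} {j : Fin (ar d.rhs.pred)}
    (hj : j ∈ d.rightIdx) : d.rhs.args j ∉ d.exVars :=
  fun h => (IND.mem_exVars.1 h).2 hj

theorem tuples_canAtom_subset {d : IND ar} {θ : ℕ → Γ} {A C S : Set (Atom ar Γ)}
    {Q : Set (Fin n → Γ)} (hCA : C ⊆ A) :
    tuples θ (interp A C S Q) d.exVars (canAtom Γ n d.rhs) ⊆
      tuples θ (interp A C S Q) d.exVars (baseAtom Γ n d.rhs) := by
  rintro v ⟨θ', h1, h2, h3⟩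
  exact ⟨θ', h1, h2, hCA h3⟩

theorem tuples_baseAtom_finite {d : IND ar} {θ : ℕ → Γ} {A C S : Set (Atom ar Γ)}
    {Q : Set (Fin n → Γ)} (hA : A.Finite) :
    (tuples θ (interp A C S Q) d.exVars (baseAtom Γ n d.rhs)).Finite := by
  classical
  -- A counted tuple can be read off from the fact it comes from, because every variable of
  -- `d.exVars` occurs in the right-hand atom. The default `[]` is never reached for such facts.
  refine (hA.image fun f => if h : ∃ θ' : ℕ → Γ, d.rhs.map θ' = f
    then d.exVars.map h.choose else []).subset ?_
  intro v hv
  obtain ⟨θ', -, rfl, h3⟩ := mem_tuples_baseAtom.1 hv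
  refine ⟨_, h3, ?_⟩
  have h : ∃ θ'' : ℕ → Γ, d.rhs.map θ'' = d.rhs.map θ' := ⟨θ', rfl⟩
  simp only [h, dite_true]
  refine List.map_congr_left fun x hx => ?_
  obtain ⟨⟨j, rfl⟩, -⟩ := IND.mem_exVars.1 hx
  have := h.choose_spec
  simp only [Atom.map, Atom.mk.injEq, heq_eq_eq, true_and] at this
  exact congrFun this j

/-- A tuple determines its assignment, which equals `θ` off `d.exVars`; hence counted tuples
correspond to witnessing facts. -/
theorem tuples_eq_iff_blocked {d : IND ar} {θ : ℕ → Γ} {A C S : Set (Atom ar Γ)}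
    {Q : Set (Fin n → Γ)} (hCA : C ⊆ A) :
    tuples θ (interp A C S Q) d.exVars (canAtom Γ n d.rhs) =
      tuples θ (interp A C S Q) d.exVars (baseAtom Γ n d.rhs) ↔ d.Blocked θ A C := by
  constructor
  · intro h a hj ha
    obtain ⟨θ', h1, h2⟩ := d.exists_extension θ a hj
    have hmap : d.rhs.map θ' = ⟨d.rhs.pred, a⟩ := by
      simp only [Atom.map, Atom.mk.injEq, heq_eq_eq, true_and]
      exact funext h2
    have hv : d.exVars.map θ' ∈ tuples θ (interp A C S Q) d.exVars (baseAtom Γ n d.rhs) :=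
      mem_tuples_baseAtom.2 ⟨θ', h1, rfl, hmap ▸ ha⟩
    rw [← h] at hv
    obtain ⟨θ'', h3, h4, h5⟩ := mem_tuples_canAtom.1 hv
    have : θ'' = θ' := by
      funext x
      by_cases hx : x ∈ d.exVars
      · exact List.map_inj_left.1 h4 x hx
      · rw [h3 x hx, h1 x hx]
    rwa [← hmap, ← this]
  · intro h
    refine (tuples_canAtom_subset hCA).antisymm ?_
    rintro v ⟨θ', h1, h2, h3⟩
    exact ⟨θ', h1, h2, h _ (fun j hj => h1 _ (IND.not_mem_exVars_of_mem_rightIdx hj)) h3⟩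

theorem IND.blocked_iff_of_exVars_eq_nil {d : IND ar} (hd : d.exVars = []) {θ : ℕ → Γ}
    {A C : Set (Atom ar Γ)} :
    d.Blocked θ A C ↔ (d.rhs.map θ ∈ A → d.rhs.map θ ∈ C) := by
  constructor
  · exact fun h => h _ fun _ _ => rfl
  · intro h a hj ha
    have : (⟨d.rhs.pred, a⟩ : Atom ar Γ) = d.rhs.map θ := by
      simp only [Atom.map, Atom.mk.injEq, heq_eq_eq, true_and]
      funext j
      refine hj j ?_
      by_contra hc
      have : d.rhs.args j ∈ d.exVars := IND.mem_exVars.2 ⟨⟨j, rfl⟩, hc⟩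
      simp [hd] at this
    rw [this] at ha ⊢
    exact h ha

theorem head_of_mem_indRules {d : IND ar} {r : Rule (Pred.arity ar n) Γ}
    (hr : r ∈ indRules Γ n d) : r.head = [canAtom Γ n d.lhs] := by
  unfold indRules at hr
  split_ifs at hr
  · rw [Set.mem_singleton_iff.1 hr]
  · rcases hr with rfl | rfl <;> rfl

theorem headTrue_of_mem_indRules {d : IND ar} {r : Rule (Pred.arity ar n) Γ}
    (hr : r ∈ indRules Γ n d) {θ : ℕ → Γ} {A C S : Set (Atom ar Γ)} {Q : Set (Fin n → Γ)} :
    r.HeadTrue θ (interp A C S Q) ↔ d.lhs.map θ ∈ C := by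
  simp only [Rule.HeadTrue, head_of_mem_indRules hr, List.mem_singleton, exists_eq_left]
  exact Iff.rfl

theorem headTrue_dcRule {c : DC ar} {θ : ℕ → Γ} {A C S : Set (Atom ar Γ)}
    {Q : Set (Fin n → Γ)} :
    (dcRule Γ n c).HeadTrue θ (interp A C S Q) ↔ ∃ a ∈ c.conj.atoms, a.map θ ∈ C := by
  simp only [Rule.HeadTrue, dcRule, List.mem_map, exists_exists_and_eq_and]
  exact Iff.rfl

theorem headTrue_queryRule {x : Fin n → ℕ} {φ : Conj ar} {θ : ℕ → Γ}
    {A C S : Set (Atom ar Γ)} {Q : Set (Fin n → Γ)} :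
    (queryRule Γ x φ).HeadTrue θ (interp A C S Q) ↔ (fun i => θ (x i)) ∈ Q := by
  simp only [Rule.HeadTrue, queryRule, List.mem_singleton, exists_eq_left]
  exact Iff.rfl

theorem headTrue_repRule {g : R} {θ : ℕ → Γ} {A C S : Set (Atom ar Γ)} {Q : Set (Fin n → Γ)} :
    (repRule Γ ar n g).HeadTrue θ (interp A C S Q) ↔ (genericAtom ar g).map θ ∈ S := by
  simp only [Rule.HeadTrue, repRule, List.mem_singleton, exists_eq_left]
  exact Iff.rfl

theorem headTrue_factRule {f : Atom ar Γ} {θ : ℕ → Γ} {A C S : Set (Atom ar Γ)}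
    {Q : Set (Fin n → Γ)} :
    (factRule n f).HeadTrue θ (interp A C S Q) ↔ f ∈ A := by
  simp only [Rule.HeadTrue, factRule, List.mem_singleton, exists_eq_left]
  exact Iff.rfl

theorem exists_map_genericAtom_eq [Nonempty Γ] (f : Atom ar Γ) :
    ∃ θ : ℕ → Γ, (genericAtom ar f.pred).map θ = f := by
  refine ⟨fun k => if h : k < ar f.pred then f.args ⟨k, h⟩ else Classical.arbitrary Γ, ?_⟩
  obtain ⟨g, x⟩ := f
  simp [genericAtom, Atom.map]

/-! ### Rule bodies, models of the reduct, and answer sets -/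

variable [LinearOrder Γ]

theorem lhs_mem_of_bodyTrue {d : IND ar} {r : Rule (Pred.arity ar n) Γ}
    (hr : r ∈ indRules Γ n d) {θ : ℕ → Γ} {A C S : Set (Atom ar Γ)} {Q : Set (Fin n → Γ)}
    (h : r.BodyTrue θ (interp A C S Q)) : d.lhs.map θ ∈ A := by
  have : Literal.pos (baseAtom Γ n d.lhs) ∈ r.body := by
    unfold indRules at hr
    split_ifs at hr
    · rw [Set.mem_singleton_iff.1 hr]
      simp
    · rcases hr with rfl | rfl <;> simp
  exact h _ this

theorem blocked_of_bodyTrue {d : IND ar} {r : Rule (Pred.arity ar n) Γ}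
    (hr : r ∈ indRules Γ n d) {θ : ℕ → Γ} {A C S : Set (Atom ar Γ)} {Q : Set (Fin n → Γ)}
    (hA : A.Finite) (hCA : C ⊆ A) (h : r.BodyTrue θ (interp A C S Q)) : d.Blocked θ A C := by
  unfold indRules at hr
  split_ifs at hr with hd
  · rw [Set.mem_singleton_iff.1 hr] at h
    have hcount := h (Literal.countEq d.exVars (canAtom Γ n d.rhs) (baseAtom Γ n d.rhs)) (by simp)
    rw [← tuples_eq_iff_blocked (S := S) (Q := Q) hCA]
    have hfin := tuples_baseAtom_finite (d := d) (θ := θ) (C := C) (S := S) (Q := Q) hA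
    -- Equal counts force equal sets because one set contains the other and both are finite.
    exact (hfin.subset (tuples_canAtom_subset hCA)).eq_of_subset_of_encard_le
      (tuples_canAtom_subset hCA) (le_of_eq hcount.symm)
  · rw [IND.blocked_iff_of_exVars_eq_nil (by simpa using hd)]
    rcases hr with rfl | rfl
    · exact fun _ => h (Literal.pos (canAtom Γ n d.rhs)) (by simp)
    · exact fun hA => (h (Literal.naf (baseAtom Γ n d.rhs)) (by simp) hA).elim

/-- A reduct instance constrains a model only when its body holds both there and in the reference
interpretation. One rule serves both: blocking by `C'` implies blocking by `C`, and without
existential variables the choice of rule depends only on the common base facts `A`. -/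
theorem exists_bodyTrue_of_blocked {d : IND ar} {θ : ℕ → Γ}
    {A C C' S S' : Set (Atom ar Γ)} {Q Q' : Set (Fin n → Γ)} (hCA : C ⊆ A) (hC : C' ⊆ C)
    (hlhs : d.lhs.map θ ∈ A) (h : d.Blocked θ A C') :
    ∃ r ∈ indRules Γ n d, r.BodyTrue θ (interp A C S Q) ∧ r.BodyTrue θ (interp A C' S' Q') := by
  unfold indRules
  split_ifs with hd
  · refine ⟨_, rfl, ?_, ?_⟩
    · intro l hl
      simp only [List.mem_cons, List.not_mem_nil, or_false] at hl
      rcases hl with rfl | rfl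
      · exact hlhs
      · exact congrArg Set.encard ((tuples_eq_iff_blocked hCA).2 (h.mono hC))
    · intro l hl
      simp only [List.mem_cons, List.not_mem_nil, or_false] at hl
      rcases hl with rfl | rfl
      · exact hlhs
      · exact congrArg Set.encard ((tuples_eq_iff_blocked (hC.trans hCA)).2 h)
  · rw [IND.blocked_iff_of_exVars_eq_nil (by simpa using hd)] at h
    by_cases hA : d.rhs.map θ ∈ A
    · refine ⟨_, Or.inl rfl, ?_, ?_⟩ <;> intro l hl <;>
        simp only [List.mem_cons, List.not_mem_nil, or_false] at hl <;> rcases hl with rfl | rfl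
      exacts [hlhs, hC (h hA), hlhs, h hA]
    · refine ⟨_, Or.inr rfl, ?_, ?_⟩ <;> intro l hl <;>
        simp only [List.mem_cons, List.not_mem_nil, or_false] at hl <;> rcases hl with rfl | rfl
      exacts [hlhs, hA, hlhs, hA]

theorem bodyTrue_dcRule {c : DC ar} {θ : ℕ → Γ} {A C S : Set (Atom ar Γ)}
    {Q : Set (Fin n → Γ)} :
    (dcRule Γ n c).BodyTrue θ (interp A C S Q) ↔ c.conj.Holds θ A := by
  simp only [Rule.BodyTrue, dcRule, List.mem_append, List.mem_map, or_imp, forall_and,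
    forall_exists_index, and_imp, forall_apply_eq_imp_iff₂]
  exact Iff.rfl

theorem bodyTrue_queryRule {x : Fin n → ℕ} {φ : Conj ar} {θ : ℕ → Γ}
    {A C S : Set (Atom ar Γ)} {Q : Set (Fin n → Γ)} :
    (queryRule Γ x φ).BodyTrue θ (interp A C S Q) ↔ φ.Holds θ S := by
  simp only [Rule.BodyTrue, queryRule, List.mem_append, List.mem_map, or_imp, forall_and,
    forall_exists_index, and_imp, forall_apply_eq_imp_iff₂]
  exact Iff.rfl

theorem bodyTrue_repRule {g : R} {θ : ℕ → Γ} {A C S : Set (Atom ar Γ)} {Q : Set (Fin n → Γ)} :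
    (repRule Γ ar n g).BodyTrue θ (interp A C S Q) ↔ (genericAtom ar g).map θ ∈ A \ C := by
  simp only [Rule.BodyTrue, repRule, List.mem_cons, List.not_mem_nil, or_false, forall_eq_or_imp,
    forall_eq]
  exact Iff.rfl

theorem isModelOfReduct_interp_iff [Nonempty Γ] (G : Schema) (D : Set (G.Fact Γ))
    (q : UCQ G.arity n) (A C S A' C' S' : Set (G.Fact Γ)) (Q Q' : Set (Fin n → Γ)) :
    IsModelOfReduct (factRules G n D ∪ Pcqa Γ G q) (interp A C S Q) (interp A' C' S' Q') ↔
      D ⊆ A' ∧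
      (∀ c ∈ G.dcs, ∀ θ : ℕ → Γ, c.conj.Holds θ A → c.conj.Holds θ A' →
        ∃ a ∈ c.conj.atoms, a.map θ ∈ C') ∧
      (∀ d ∈ G.inds, ∀ r ∈ indRules Γ n d, ∀ θ : ℕ → Γ, r.BodyTrue θ (interp A C S Q) →
        r.BodyTrue θ (interp A' C' S' Q') → d.lhs.map θ ∈ C') ∧
      (A \ C) ∩ (A' \ C') ⊆ S' ∧
      (∀ φ ∈ q.disjuncts, ∀ θ : ℕ → Γ, φ.Holds θ S → φ.Holds θ S' →
        (fun i => θ (q.free i)) ∈ Q') := by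
  constructor
  · intro h
    refine ⟨fun f hf => ?_, fun c hc θ h1 h2 => ?_, fun d hd r hr θ h1 h2 => ?_, ?_,
      fun φ hφ θ h1 h2 => ?_⟩
    · have hbody : ∀ J, (factRule n f).BodyTrue (fun _ => Classical.arbitrary Γ) J :=
        fun J l hl => (List.not_mem_nil hl).elim
      exact headTrue_factRule.1 (h _ (Or.inl ⟨f, hf, rfl⟩) _ (hbody _) (hbody _))
    · exact headTrue_dcRule.1 (h _ (Or.inr (Or.inl (Or.inl (Or.inl ⟨c, hc, rfl⟩)))) θ
        (bodyTrue_dcRule.2 h1) (bodyTrue_dcRule.2 h2))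
    · exact (headTrue_of_mem_indRules hr).1
        (h r (Or.inr (Or.inl (Or.inl (Or.inr ⟨d, hd, hr⟩)))) θ h1 h2)
    · rintro f ⟨h1, h2⟩
      obtain ⟨θ, hθ⟩ := exists_map_genericAtom_eq f
      have := headTrue_repRule.1 (h _ (Or.inr (Or.inl (Or.inr ⟨f.pred, rfl⟩))) θ
        (bodyTrue_repRule.2 (hθ ▸ h1)) (bodyTrue_repRule.2 (hθ ▸ h2)))
      rwa [hθ] at this
    · exact headTrue_queryRule.1 (h _ (Or.inr (Or.inr ⟨φ, hφ, rfl⟩)) θ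
        (bodyTrue_queryRule.2 h1) (bodyTrue_queryRule.2 h2))
  · rintro ⟨hD, hdc, hind, hrep, hq⟩ r hr θ h1 h2
    rcases hr with ⟨f, hf, rfl⟩ | ((⟨c, hc, rfl⟩ | ⟨d, hd, hr⟩) | ⟨g, rfl⟩) | ⟨φ, hφ, rfl⟩
    · exact headTrue_factRule.2 (hD hf)
    · exact headTrue_dcRule.2 (hdc c hc θ (bodyTrue_dcRule.1 h1) (bodyTrue_dcRule.1 h2))
    · exact (headTrue_of_mem_indRules hr).2 (hind d hd r hr θ h1 h2)
    · exact headTrue_repRule.2 (hrep ⟨bodyTrue_repRule.1 h1, bodyTrue_repRule.1 h2⟩)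
    · exact headTrue_queryRule.2
        (hq φ hφ θ (bodyTrue_queryRule.1 h1) (bodyTrue_queryRule.1 h2))

theorem mem_ans_of_holds {q : UCQ ar n} {φ : Conj ar} (hφ : φ ∈ q.disjuncts) {θ : ℕ → Γ}
    {S : Set (Atom ar Γ)} (h : φ.Holds θ S) : (fun i => θ (q.free i)) ∈ q.ans S :=
  ⟨φ, hφ, θ, fun _ => rfl, h⟩

theorem ans_subset_of_holds {q : UCQ ar n} {S : Set (Atom ar Γ)} {Q : Set (Fin n → Γ)}
    (h : ∀ φ ∈ q.disjuncts, ∀ θ : ℕ → Γ, φ.Holds θ S → (fun i => θ (q.free i)) ∈ Q) :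
    q.ans S ⊆ Q := by
  rintro t ⟨φ, hφ, θ, ht, hS⟩
  obtain rfl : (fun i => θ (q.free i)) = t := funext ht
  exact h φ hφ θ hS

theorem consistent_diff_of_isModelOfReduct [Nonempty Γ] {G : Schema} {D : Set (G.Fact Γ)}
    {q : UCQ G.arity n} {C C' S S' : Set (G.Fact Γ)} {Q Q' : Set (Fin n → Γ)}
    (hCD : C ⊆ D) (hC : C' ⊆ C)
    (h : IsModelOfReduct (factRules G n D ∪ Pcqa Γ G q) (interp D C S Q) (interp D C' S' Q')) :
    G.Consistent (D \ C') := by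
  obtain ⟨-, hdc, hind, -, -⟩ := (isModelOfReduct_interp_iff ..).1 h
  refine ⟨fun c hc θ hθ => ?_, fun d hd => ?_⟩
  · obtain ⟨a, ha, haC⟩ := hdc c hc θ (hθ.mono Set.sdiff_subset) (hθ.mono Set.sdiff_subset)
    exact (hθ.1 a ha).2 haC
  · rw [IND.sat_diff_iff]
    intro θ hlhs hb
    obtain ⟨r, hr, h1, h2⟩ := exists_bodyTrue_of_blocked hCD hC hlhs hb
    exact hind d hd r hr θ h1 h2

/-- Cancelling fewer facts need not enlarge `S`: the rule instances deriving repaired facts from `C`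
are absent from the reduct, so only `D \ C ⊆ S` is needed. -/
theorem isModelOfReduct_of_consistent [Nonempty Γ] {G : Schema} {D : Set (G.Fact Γ)}
    (hD : D.Finite) {q : UCQ G.arity n} {C M S : Set (G.Fact Γ)} {Q : Set (Fin n → Γ)}
    (hM : G.Consistent M) (hMD : M ⊆ D) (hS : D \ C ⊆ S) (hQ : q.ans S ⊆ Q) :
    IsModelOfReduct (factRules G n D ∪ Pcqa Γ G q) (interp D C S Q)
      (interp D (D \ M) S Q) := by
  rw [isModelOfReduct_interp_iff]
  refine ⟨le_rfl, fun c hc θ h _ => ?_, fun d hd r hr θ _ h => ?_,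
    Set.inter_subset_left.trans hS, fun φ hφ θ h _ => hQ (mem_ans_of_holds hφ h)⟩
  · by_contra! hno
    refine hM.1 c hc θ ⟨fun a ha => ?_, h.2⟩
    by_contra haM
    exact hno a ha ⟨h.1 a ha, haM⟩
  · have hsat : d.Sat (D \ (D \ M)) := by
      rw [Set.sdiff_sdiff_cancel_left hMD]
      exact hM.2 d hd
    exact (d.sat_diff_iff D _).1 hsat θ (lhs_mem_of_bodyTrue hr h)
      (blocked_of_bodyTrue hr hD Set.sdiff_subset h)

theorem isAnswerSet_of_isMaxConsistentSubset [Nonempty Γ] {G : Schema} {D M : Set (G.Fact Γ)}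
    (hD : D.Finite) (q : UCQ G.arity n) (hM : IsMaxConsistentSubset G D M) :
    IsAnswerSet (factRules G n D ∪ Pcqa Γ G q) (interp D (D \ M) M (q.ans M)) := by
  have hMD := hM.prop.1
  refine ⟨isModelOfReduct_of_consistent hD hM.prop.2 hMD
    (Set.sdiff_sdiff_cancel_left hMD).subset le_rfl, fun J hJ hle => ?_⟩
  obtain ⟨A', C', S', Q', rfl⟩ := exists_eq_interp J
  obtain ⟨hA, hC, hS, hQ⟩ := interp_subset_interp.1 hle
  obtain ⟨hDA, -, -, hrep, hq⟩ := (isModelOfReduct_interp_iff ..).1 hJ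
  obtain rfl : A' = D := hA.antisymm hDA
  -- A smaller model cancels less, so its uncancelled part is a consistent subset of `D` containing
  -- `M`, hence equal to `M`.
  have hcons := consistent_diff_of_isModelOfReduct Set.sdiff_subset hC hJ
  have hMC : M ⊆ A' \ C' := fun x hx => ⟨hMD hx, fun hxC => (hC hxC).2 hx⟩
  have hMeq : M = A' \ C' := hM.eq_of_subset ⟨Set.sdiff_subset, hcons⟩ hMC
  have hMS : M ⊆ S' := fun x hx => hrep ⟨⟨hMD hx, fun h => h.2 hx⟩, hMC hx⟩
  refine interp_subset_interp.2 ⟨le_rfl, ?_, hMS, ?_⟩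
  · rintro x ⟨hx, hxM⟩
    by_contra hxC
    exact hxM (hMeq ▸ ⟨hx, hxC⟩)
  · exact ans_subset_of_holds fun φ hφ θ h => hq φ hφ θ h (h.mono hMS)

theorem exists_of_isAnswerSet [Nonempty Γ] {G : Schema} {D : Set (G.Fact Γ)} (hD : D.Finite)
    {q : UCQ G.arity n} {I : Set (Atom (Pred.arity G.arity n) Γ)}
    (hI : IsAnswerSet (factRules G n D ∪ Pcqa Γ G q) I) :
    ∃ M, IsMaxConsistentSubset G D M ∧ I = interp D (D \ M) M (q.ans M) := by
  obtain ⟨A, C, S, Q, rfl⟩ := exists_eq_interp I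
  obtain ⟨hDA, hdc, hind, hrep, hq⟩ := (isModelOfReduct_interp_iff ..).1 hI.prop
  -- Supportedness: discarding every atom that no rule can derive from `D` leaves a model of the
  -- reduct, so by minimality nothing is discarded.
  have hsupp : interp A C S Q ⊆
      interp D (C ∩ D) (S ∩ (D \ C)) (Q ∩ q.ans (S ∩ (D \ C))) := by
    refine hI.le_of_le ((isModelOfReduct_interp_iff ..).2 ⟨le_rfl, fun c hc θ h1 h2 => ?_,
      fun d hd r hr θ h1 h2 => ⟨hind d hd r hr θ h1 h1, lhs_mem_of_bodyTrue hr h2⟩, ?_,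
      fun φ hφ θ h1 h2 => ⟨hq φ hφ θ h1 h1, mem_ans_of_holds hφ h2⟩⟩)
      (interp_subset_interp.2 ⟨hDA, Set.inter_subset_left, Set.inter_subset_left,
        Set.inter_subset_left⟩)
    · obtain ⟨a, ha, haC⟩ := hdc c hc θ h1 h1
      exact ⟨a, ha, haC, h2.1 a ha⟩
    · rintro f ⟨h1, h2⟩
      exact ⟨hrep ⟨h1, h1⟩, h2.1, h1.2⟩
  obtain ⟨hA, hC, hS, hQ⟩ := interp_subset_interp.1 hsupp
  obtain rfl : A = D := hA.antisymm hDA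
  have hCA : C ⊆ A := fun x hx => (hC hx).2
  obtain rfl : S = A \ C :=
    Set.Subset.antisymm (fun x hx => (hS hx).2) fun x hx => hrep ⟨hx, hx⟩
  have hQ' : q.ans (A \ C) ⊆ Q := ans_subset_of_holds fun φ hφ θ h => hq φ hφ θ h h
  obtain rfl : Q = q.ans (A \ C) :=
    Set.Subset.antisymm (fun x hx => q.ans_mono Set.inter_subset_left (hQ hx).2) hQ'
  refine ⟨A \ C, ⟨⟨Set.sdiff_subset, consistent_diff_of_isModelOfReduct hCA le_rfl hI.prop⟩,
    ?_⟩, by rw [Set.sdiff_sdiff_cancel_left hCA]⟩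
  rintro M ⟨hMA, hM⟩ hle
  -- A larger consistent `M` would cancel less, giving with the same `S` and `Q` a smaller model of
  -- the reduct; minimality then puts `C` inside `A \ M`.
  have hCM : A \ M ⊆ C := by
    rintro x ⟨hx, hxM⟩
    by_contra hxC
    exact hxM (hle ⟨hx, hxC⟩)
  have h := hI.le_of_le (isModelOfReduct_of_consistent (q := q) hD hM hMA le_rfl le_rfl)
    (interp_subset_interp.2 ⟨le_rfl, hCM, le_rfl, le_rfl⟩)
  exact fun x hx => ⟨hMA hx, fun hxC => ((interp_subset_interp.1 h).2.1 hxC).2 hx⟩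

theorem cautiousConsequence_queryAtom_iff [Nonempty Γ] {G : Schema} {D : Set (G.Fact Γ)}
    (hD : D.Finite) (q : UCQ G.arity n) (t : Fin n → Γ) :
    CautiousConsequence (factRules G n D ∪ Pcqa Γ G q) (queryAtom G.arity t) ↔
      ∀ M, IsMaxConsistentSubset G D M → t ∈ q.ans M := by
  constructor
  · exact fun h M hM => h _ (isAnswerSet_of_isMaxConsistentSubset hD q hM)
  · intro h I hI
    obtain ⟨M, hM, rfl⟩ := exists_of_isAnswerSet hD hI
    exact h M hM

end AnswerSets

end CQA

theorem mainTheorem7 {Γ : Type*} [LinearOrder Γ] [Countable Γ] [Infinite Γ]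
    (G : CQA.Schema) (D : Set (G.Fact Γ)) (hD : D.Finite)
    (hG : G.DCsOnly ∨ G.INDsOnly ∨ (G.KDsFKsOnly ∧ G.SatDCs D) ∨ G.KDsSFKsOnly)
    {n : ℕ} (q : CQA.UCQ G.arity n) (t : Fin n → Γ) :
    t ∈ CQA.looselyExactAns G q D ↔
      CQA.CautiousConsequence (CQA.factRules G n D ∪ CQA.Pcqa Γ G q)
        (CQA.queryAtom G.arity t) := by
  rw [CQA.mem_looselyExactAns_iff hD hG q t, CQA.cautiousConsequence_queryAtom_iff hD q t]
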